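/- **Corollary 1 (general antenna selection-based OIA).** Consider the uplink of a $K$-cell network ($K\ge 1$). Each cell $i$ has one base station (BS) with $M$ antennas and $N$ users with $L$ antennas each. Let $1\le S\le M$ be fixed, and let $N$ and $L$ be functions of $\mathrm{SNR}$ with $NL\ge S$. The channel $\mathbf H_k^{[i,j]}\in\mathbb C^{M\times L}$ from user $j$ of cell $i$ to BS $k$ has columns $\mathbf h_{k,l}^{[i,j]}$, $1\le l\le L$, and all entries of all these matrices are i.i.d. circularly symmetric complex Gaussian with mean $0$ and a fixed positive variance. Each BS $k$ fixes a full-rank matrix $\mathbf Q_k\in\mathbb C^{M\times(M-S)}$ (its interference basis) and a matrix $\mathbf U_k\in\mathbb C^{M\times S}$ whose columns form an orthonormal basis of the null space of $\mathbf Q_k^H$; these may be random, with $(\mathbf U_k)_k$ independent of the channels. The leakage of interference (LIF) metric of antenna $l$ of user $j$ in cell $i$ is $\sum_{k\ne i}\|\mathbf U_k^H\mathbf h_{k,l}^{[i,j]}\|^2$. In cell $i$, user $j$ selects $n^{[i,j]}\in\{1,\dots,L\}$ antennas with the smallest LIF metrics, and BS $i$ selects $S_i$ users with the smallest sum-LIF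 metrics (the sum-LIF of a user being the sum of the metrics of its selected antennas). The numbers $n^{[i,j]}$ and $S_i$ are chosen, as a measurable function of the LIF metrics of the cell (with arbitrary tie-breaking), such that the numbers $n^{[i,j]}$ of the $S_i$ selected users sum to $S$, and such that, among all such choices, the sum of the LIF metrics of the selected $S$ spatial channels is minimal. Each selected antenna transmits one stream of unit power, and the noise variance is $\mathrm{SNR}^{-1}$ per BS antenna. Let $\mathbf h_i^{(k,s)}$ be the channel vector to BS $i$ of the $s$-th selected spatial channel of cell $k$, $1\le s\le S$. BS $i$ applies $\mathbf U_i^H$ and then the zero-forcing equalizer $\mathbf F_i=[\mathbf f_{i,1},\dots,\mathbf f_{i,S}]=\big([\mathbf U_i^H\mathbf h_i^{(i,1)},\dots,\mathbf U_i^H\mathbf h_i^{(i,S)}]^{-1}\big)^H$, so that stream $s$ of cell $i$ has the rate $$R_{i,s}=\log\Big(1+\frac{\mathrm{SNR}}{\|\mathbf f_{i,s}\|^2+I_{i,s}}\Big),\qquad I_{i,s}=\sum_{k\ne i}\sum_{m=1}^S\big|\mathbf f_{i,s}^H\mathbf U_i^H\mathbf h_i^{(k,m)}\big|^2\,\mathrm{SNR}.$$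 If $N=\omega\big(L^{-1}\mathrm{SNR}^{(K-1)S}\big)$, i.e. $L^{-1}\mathrm{SNR}^{(K-1)S}/N\to0$ as $\mathrm{SNR}\to\infty$, then this scheme achieves $KS$ degrees of freedom with high probability: $$\frac{\sum_{i=1}^K\sum_{s=1}^S R_{i,s}}{\log \mathrm{SNR}}\longrightarrow KS\quad\text{in probability as }\mathrm{SNR}\to\infty .$$ -/

import Mathlib

open MeasureTheory ProbabilityTheory Filter Topology Asymptotics
open scoped NNReal Matrix

/-- The law of a circularly symmetric complex Gaussian variable with mean `0` and variance `v`: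
independent real and imaginary parts, each centred Gaussian of variance `v / 2`. -/
noncomputable def complexGaussian (v : ℝ≥0) : Measure ℂ :=
  ((gaussianReal 0 (v / 2)).prod (gaussianReal 0 (v / 2))).map (fun p : ℝ × ℝ => ⟨p.1, p.2⟩)

/-- Channel coefficients of a `K`-cell network with `N` users per cell, `M` antennas per base
station and `L` antennas per user: `H k i j` is the matrix from user `j` of cell `i` to BS `k`. -/
abbrev Channel (K N M L : ℕ) : Type :=
  Fin K → Fin K → Fin N → Matrix (Fin M) (Fin L) ℂ

/-- All the channel coefficients are independent with the same law, complex Gaussian with mean `0`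
and variance `v`. -/
structure IsGaussianChannel {Ω : Type*} [MeasurableSpace Ω] (P : Measure Ω) (v : ℝ≥0)
    {K N M L : ℕ} (H : Ω → Channel K N M L) : Prop where
  hasLaw : ∀ k i j m l, HasLaw (fun ω => H ω k i j m l) (complexGaussian v) P
  indep : iIndepFun
    (fun (e : Fin K × Fin K × Fin N × Fin M × Fin L) (ω : Ω) =>
      H ω e.1 e.2.1 e.2.2.1 e.2.2.2.1 e.2.2.2.2) P

/-- `Q` is a basis (of `M - S` columns) of an interference space in `ℂ^M`, and the `S` columns of
`U` form an orthonormal basis of the orthogonal complement (the null space of `Qᴴ`). -/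
structure IsReferenceBasis {M S : ℕ} (Q : Matrix (Fin M) (Fin (M - S)) ℂ)
    (U : Matrix (Fin M) (Fin S) ℂ) : Prop where
  rank_eq : Q.rank = M - S
  orthogonal : Qᴴ * U = 0
  orthonormal : Uᴴ * U = 1

/-- The projected channel vector `U_kᴴ h_{k,l}^{[i,j]}`, where `h_{k,l}^{[i,j]}` is the `l`-th
column of the channel matrix from user `j` of cell `i` to BS `k`. -/
noncomputable def projectedChannel {K N M L S : ℕ} (U : Fin K → Matrix (Fin M) (Fin S) ℂ)
    (H : Channel K N M L) (k i : Fin K) (j : Fin N) (l : Fin L) : EuclideanSpace ℂ (Fin S) :=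
  WithLp.toLp 2 ((U k)ᴴ *ᵥ (fun m => H k i j m l))

/-- The leakage of interference (LIF) metric of antenna `l` of user `j` in cell `i`. -/
noncomputable def lif {K N M L S : ℕ} (U : Fin K → Matrix (Fin M) (Fin S) ℂ)
    (H : Channel K N M L) (i : Fin K) (j : Fin N) (l : Fin L) : ℝ :=
  ∑ k ∈ Finset.univ.filter (fun k => k ≠ i), ‖projectedChannel U H k i j l‖ ^ 2

/-- An antenna and user selection within one cell. -/
structure Allocation (N L S : ℕ) where
  /-- the transmit antennas chosen by each user; the number `n^{[j]}` is the cardinality -/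
  antennas : Fin N → Finset (Fin L)
  /-- the users chosen by the base station; the number `S_i` is the cardinality -/
  users : Finset (Fin N)
  /-- an enumeration of the selected spatial channels, as pairs (user, antenna) -/
  stream : Fin S → Fin N × Fin L

namespace Allocation

variable {N L S : ℕ}

/-- The sum-LIF metric of user `j`, for a table `x` of LIF metrics. -/
noncomputable def sumLIF (x : Fin N → Fin L → ℝ) (a : Allocation N L S) (j : Fin N) : ℝ :=
  ∑ l ∈ a.antennas j, x j l

/-- The sum-LIF of all the selected spatial channels of the cell. -/
noncomputable def totalLIF (x : Fin N → Fin L → ℝ) (a : Allocation N L S) : ℝ :=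
  ∑ j ∈ a.users, a.sumLIF x j

/-- Every user selects some number (at least one) of antennas with the smallest LIF metrics, the
base station selects some number of users with the smallest sum-LIF metrics, and the selected users
have `S` streams altogether. -/
structure IsFeasible (x : Fin N → Fin L → ℝ) (a : Allocation N L S) : Prop where
  one_le_card : ∀ j, 1 ≤ (a.antennas j).card
  antennas_smallest : ∀ j, ∀ l ∈ a.antennas j, ∀ l' ∉ a.antennas j, x j l ≤ x j l'
  users_smallest : ∀ j ∈ a.users, ∀ j' ∉ a.users, a.sumLIF x j ≤ a.sumLIF x j'
  card_streams : ∑ j ∈ a.users, (a.antennas j).card = S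
  stream_bijOn :
    Set.BijOn a.stream Set.univ {p | p.1 ∈ a.users ∧ p.2 ∈ a.antennas p.1}

/-- The numbers of antennas and of users are chosen so that the sum-LIF of the selected `S` spatial
channels is minimized. -/
def IsOptimal (x : Fin N → Fin L → ℝ) (a : Allocation N L S) : Prop :=
  a.IsFeasible x ∧ ∀ b : Allocation N L S, b.IsFeasible x → a.totalLIF x ≤ b.totalLIF x

end Allocation

/-- A (measurable) selection rule of the general antenna selection-based OIA: from the LIF metrics
of a cell it computes an optimal allocation; ties are broken in an arbitrary way. -/
structure IsGeneralSelectionRule {N L S : ℕ}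
    (sel : (Fin N → Fin L → ℝ) → Allocation N L S) : Prop where
  optimal : ∀ x, (sel x).IsOptimal x
  measurable : ∀ a, MeasurableSet {x | sel x = a}

/-- The effective channel `U_iᴴ h` at BS `i` of the `s`-th selected spatial channel of cell `k`,
when the cells use the allocations `a`. -/
noncomputable def effectiveChannel {K N M L S : ℕ} (U : Fin K → Matrix (Fin M) (Fin S) ℂ)
    (H : Channel K N M L) (a : Fin K → Allocation N L S) (i k : Fin K) (s : Fin S) :
    EuclideanSpace ℂ (Fin S) :=
  projectedChannel U H i k ((a k).stream s).1 ((a k).stream s).2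

/-- The zero-forcing equalizer `F_i`: the conjugate transpose of the inverse of the matrix whose
columns are the effective channels of the streams of cell `i`. -/
noncomputable def zfEqualizer {K N M L S : ℕ} (U : Fin K → Matrix (Fin M) (Fin S) ℂ)
    (H : Channel K N M L) (a : Fin K → Allocation N L S) (i : Fin K) :
    Matrix (Fin S) (Fin S) ℂ :=
  ((Matrix.of (fun r s => effectiveChannel U H a i i s r))⁻¹)ᴴ

/-- The column `f_{i,s}` of the zero-forcing equalizer. -/
noncomputable def zfVector {K N M L S : ℕ} (U : Fin K → Matrix (Fin M) (Fin S) ℂ)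
    (H : Channel K N M L) (a : Fin K → Allocation N L S) (i : Fin K) (s : Fin S) :
    EuclideanSpace ℂ (Fin S) :=
  WithLp.toLp 2 (fun r => zfEqualizer U H a i r s)

/-- The sum-interference `I_{i,s}` from the other cells in the `s`-th stream of cell `i`. -/
noncomputable def interference {K N M L S : ℕ} (snr : ℝ) (U : Fin K → Matrix (Fin M) (Fin S) ℂ)
    (H : Channel K N M L) (a : Fin K → Allocation N L S) (i : Fin K) (s : Fin S) : ℝ :=
  ∑ k ∈ Finset.univ.filter (fun k => k ≠ i), ∑ m : Fin S,
    ‖inner ℂ (zfVector U H a i s) (effectiveChannel U H a i k m)‖ ^ 2 * snr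

/-- The achievable rate `log (1 + SINR)` of the `s`-th stream of cell `i`. (If the matrix inverted
in the equalizer is singular, the conventions on inverses make this rate `0`.) -/
noncomputable def streamRate {K N M L S : ℕ} (snr : ℝ) (U : Fin K → Matrix (Fin M) (Fin S) ℂ)
    (H : Channel K N M L) (a : Fin K → Allocation N L S) (i : Fin K) (s : Fin S) : ℝ :=
  Real.log (1 + snr / (‖zfVector U H a i s‖ ^ 2 + interference snr U H a i s))

/-- The sum-rate over all the streams of all the cells. -/
noncomputable def sumRate {K N M L S : ℕ} (snr : ℝ) (U : Fin K → Matrix (Fin M) (Fin S) ℂ)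
    (H : Channel K N M L) (a : Fin K → Allocation N L S) : ℝ :=
  ∑ i : Fin K, ∑ s : Fin S, streamRate snr U H a i s

/-- The random sum-rate `R snr` achieves `d` degrees of freedom with high probability: the ratio
`R snr / log snr` converges to `d` in probability as `snr → ∞`. -/
def AchievesDoFWithHighProbability {Ω : Type*} [MeasurableSpace Ω] (P : Measure Ω)
    (R : ℝ → Ω → ℝ) (d : ℝ) : Prop :=
  TendstoInMeasure P (fun snr ω => R snr ω / Real.log snr) atTop (fun _ => d)

/-! The scheme sees the channels only through the projections `U_kᴴ h`. As `U_k` has orthonormal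
columns and is independent of the channels, these projections are again i.i.d. complex Gaussian
(`hasLaw_projectedTable`), so one may take `S` antennas per base station and identity bases.

The LIF metrics of cell `i` involve only channels to the other base stations, hence are independent
of the channels from cell `i` to its own one. Selection therefore does not bias the own effective
matrix: it is an `S × S` Gaussian matrix whose law does not depend on the SNR
(`measure_ownEntries_le`). It is almost surely invertible, so outside an event of small probability,
uniformly in the SNR, the equalizer columns have squared norms in a fixed interval `[1/(n+1), n+1]`
(`tendsto_measure_zfExceptional`).

A LIF metric is a sum of `(K-1)S` squared Gaussian moduli, so it is at most `1/snr` with probability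
at least a constant times `snr^(-(K-1)S)`. The scaling condition makes the expected number of such
antennas in a cell diverge, and Chernoff's bound yields at least `S` of them with high probability
(`measure_card_lif_le_lt_le`). The `S` best channels form a feasible allocation, so optimality
bounds the selected leakage by `S/snr` (`IsOptimal.stream_le`). Interference then stays bounded,
every rate is `log snr + O(1)`, and division by `log snr` gives the limit. -/

/-! ### Complex Gaussian vectors and their invariance under orthonormal rows. -/

instance (v : ℝ≥0) : IsProbabilityMeasure (complexGaussian v) := by
  unfold complexGaussian
  exact Measure.isProbabilityMeasure_map
    (Complex.measurableEquivRealProd.symm.measurable.aemeasurable)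

lemma complexGaussian_eq_map (v : ℝ≥0) : complexGaussian v =
    ((gaussianReal 0 (v / 2)).prod (gaussianReal 0 (v / 2))).map
      Complex.measurableEquivRealProd.symm := rfl

/-- Only `‖t‖` enters. For a vector of i.i.d. variables the characteristic function therefore
depends on the Euclidean norm alone, which is what an isometry preserves. -/
lemma charFun_complexGaussian (v : ℝ≥0) (t : ℂ) :
    charFun (complexGaussian v) t = Complex.exp (-(v / 4) * ((‖t‖ ^ 2 : ℝ) : ℂ)) := by
  rw [complexGaussian_eq_map, charFun_apply, integral_map_equiv]
  have h : ∀ p : ℝ × ℝ,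
      Complex.exp (((inner ℝ (Complex.measurableEquivRealProd.symm p) t : ℝ) : ℂ) * Complex.I) =
      Complex.exp (t.re * p.1 * Complex.I) * Complex.exp (t.im * p.2 * Complex.I) := by
    intro p
    rw [← Complex.exp_add]
    congr 1
    rw [Complex.inner]
    simp [Complex.measurableEquivRealProd]
    ring
  simp_rw [h]
  rw [integral_prod_mul (fun x : ℝ => Complex.exp (t.re * x * Complex.I))
    (fun x : ℝ => Complex.exp (t.im * x * Complex.I)), ← charFun_apply_real, ← charFun_apply_real,
    charFun_gaussianReal, charFun_gaussianReal, ← Complex.exp_add]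
  congr 1
  rw [Complex.sq_norm, Complex.normSq_apply]
  push_cast
  ring

lemma dotProduct_star_conjTranspose_mulVec {ι κ : Type*} [Fintype ι] [Fintype κ]
    (A : Matrix κ ι ℂ) (x : ι → ℂ) (t : κ → ℂ) : star (A *ᵥ x) ⬝ᵥ t = star x ⬝ᵥ (Aᴴ *ᵥ t) := by
  rw [Matrix.star_mulVec, ← Matrix.dotProduct_mulVec]

lemma sum_sq_norm_conjTranspose_mulVec {ι κ : Type*} [Fintype ι] [Fintype κ] [DecidableEq κ]
    (A : Matrix κ ι ℂ) (hA : A * Aᴴ = 1) (t : κ → ℂ) :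
    ∑ i, ‖(Aᴴ *ᵥ t) i‖ ^ 2 = ∑ i, ‖t i‖ ^ 2 := by
  have h : star (Aᴴ *ᵥ t) ⬝ᵥ (Aᴴ *ᵥ t) = star t ⬝ᵥ t := by
    rw [dotProduct_star_conjTranspose_mulVec, Matrix.conjTranspose_conjTranspose,
      Matrix.mulVec_mulVec, hA, Matrix.one_mulVec]
  simp only [dotProduct, Pi.star_apply, RCLike.star_def, Complex.conj_mul'] at h
  exact_mod_cast h

/-- A matrix with orthonormal rows maps a vector of i.i.d. circularly symmetric Gaussian variables
to such a vector. -/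
lemma map_mulVec_pi_complexGaussian {ι κ : Type*} [Fintype ι] [Fintype κ] [DecidableEq κ]
    (v : ℝ≥0) (A : Matrix κ ι ℂ) (hA : A * Aᴴ = 1) :
    (Measure.pi fun _ : ι => complexGaussian v).map (fun x => A *ᵥ x) =
      Measure.pi fun _ : κ => complexGaussian v := by
  have hm : Measurable (fun x : ι → ℂ => A *ᵥ x) := by
    refine Continuous.measurable ?_
    fun_prop
  have : IsProbabilityMeasure
      ((Measure.pi fun _ : ι => complexGaussian v).map (fun x => A *ᵥ x)) :=
    Measure.isProbabilityMeasure_map hm.aemeasurable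
  refine charFun_eq_pi_iff.1 fun t => ?_
  -- The matrix moves to the argument as its adjoint, which is an isometry because `A * Aᴴ = 1`.
  have h1 : charFun (((Measure.pi fun _ : ι => complexGaussian v).map (fun x => A *ᵥ x)).map
      (WithLp.toLp 2)) t = charFun ((Measure.pi fun _ : ι => complexGaussian v).map
      (WithLp.toLp 2)) (WithLp.toLp 2 (Aᴴ *ᵥ t.ofLp)) := by
    rw [charFun_apply, charFun_apply, ← MeasurableEquiv.coe_toLp, ← MeasurableEquiv.coe_toLp,
      integral_map_equiv, integral_map_equiv, integral_map hm.aemeasurable]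
    · congr 1
      ext x
      congr 3
      have h := congrArg Complex.re (dotProduct_star_conjTranspose_mulVec A x t.ofLp)
      simp only [dotProduct, Complex.re_sum] at h
      simp only [MeasurableEquiv.coe_toLp, PiLp.inner_apply, Complex.inner]
      simpa only [mul_comm, Pi.star_apply, RCLike.star_def] using h
    · refine Continuous.aestronglyMeasurable ?_
      simp only [MeasurableEquiv.coe_toLp]
      fun_prop
  rw [h1, charFun_pi]
  simp_rw [charFun_complexGaussian]
  rw [← Complex.exp_sum, ← Complex.exp_sum, ← Finset.mul_sum, ← Finset.mul_sum]
  congr 2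
  have := sum_sq_norm_conjTranspose_mulVec A hA t.ofLp
  exact_mod_cast this

/-! ### Polynomial null sets and probabilities of small discs. -/

/-- The zero set of a nonzero polynomial is a null set for a product of atomless laws. -/
lemma pi_eval_eq_zero_fin (μ : Measure ℂ) [IsProbabilityMeasure μ] [NullSingletonClass μ] :
    ∀ (n : ℕ) (p : MvPolynomial (Fin n) ℂ), p ≠ 0 →
      (Measure.pi fun _ : Fin n => μ) {x | MvPolynomial.eval x p = 0} = 0 := by
  intro n
  induction n with
  | zero =>
    intro p hp
    have : {x | MvPolynomial.eval x p = 0} = ∅ := by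
      ext x
      simp only [Set.mem_ofPred_eq, Set.mem_empty_iff_false, iff_false]
      rw [MvPolynomial.eq_C_of_isEmpty p] at hp ⊢
      simpa using hp
    rw [this, measure_empty]
  | succ n ih =>
    intro p hp
    set q := MvPolynomial.finSuccEquiv ℂ n p with hq
    have hq0 : q ≠ 0 := by simpa [hq] using hp
    have hmeas : MeasurableSet {x | MvPolynomial.eval x p = 0} :=
      (isClosed_eq (MvPolynomial.continuous_eval p) continuous_const).measurableSet
    have e := (measurePreserving_piFinSuccAbove (fun _ : Fin (n + 1) => μ) 0).symm
    have hq1 : q.leadingCoeff ≠ 0 := by simpa using hq0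
    -- Fubini with the last `n` coordinates outside: by induction the leading coefficient in the
    -- first variable is almost surely nonzero there, leaving a one-variable polynomial with
    -- finitely many roots.
    rw [← e.measure_preimage hmeas.nullMeasurableSet, ← Measure.prod_swap,
      Measure.map_apply measurable_swap (e.measurable hmeas),
      Measure.measure_prod_null (measurable_swap (e.measurable hmeas))]
    have hae : ∀ᵐ s ∂(Measure.pi fun _ : Fin n => μ), MvPolynomial.eval s q.leadingCoeff ≠ 0 := by
      rw [ae_iff]
      simpa using ih _ hq1
    filter_upwards [hae] with s hs
    have hr : q.map (MvPolynomial.eval s) ≠ 0 := fun h0 => hs <| by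
      simpa using congrArg (fun r => r.coeff q.natDegree) h0
    refine measure_mono_null (t := {y | y ∈ (q.map (MvPolynomial.eval s)).roots.toFinset})
      (fun y hy => ?_) (Finset.measure_zero _ _)
    have hy' : MvPolynomial.eval (Fin.cons y s : Fin (n + 1) → ℂ) p = 0 := by
      have : (MeasurableEquiv.piFinSuccAbove (fun _ : Fin (n + 1) => ℂ) 0).symm (y, s) =
        (Fin.cons y s : Fin (n + 1) → ℂ) := by
        simp only [MeasurableEquiv.piFinSuccAbove, Fin.insertNthEquiv_zero]
        rfl
      rw [← this]
      exact hy
    rw [MvPolynomial.eval_eq_eval_mv_eval'] at hy'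
    simpa [hr] using hy'

lemma pi_eval_eq_zero {ι : Type*} [Fintype ι] (μ : Measure ℂ) [IsProbabilityMeasure μ]
    [NullSingletonClass μ] (p : MvPolynomial ι ℂ) (hp : p ≠ 0) :
    (Measure.pi fun _ : ι => μ) {x | MvPolynomial.eval x p = 0} = 0 := by
  let e := Fintype.equivFin ι
  have hmeas : MeasurableSet {x | MvPolynomial.eval x p = 0} :=
      (isClosed_eq (MvPolynomial.continuous_eval p) continuous_const).measurableSet
  have h := measurePreserving_piCongrLeft (fun _ : ι => μ) e.symm
  rw [← h.measure_preimage hmeas.nullMeasurableSet]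
  convert pi_eval_eq_zero_fin μ _ (MvPolynomial.rename e p)
    (by simpa using (MvPolynomial.rename_injective e e.injective).ne hp) using 2
  ext x
  have hx : MeasurableEquiv.piCongrLeft (fun _ : ι => ℂ) e.symm x = x ∘ e := by
    ext i
    simp [MeasurableEquiv.piCongrLeft, Equiv.piCongrLeft]
  rw [Set.mem_preimage, hx, Set.mem_ofPred_eq, Set.mem_ofPred_eq, MvPolynomial.eval_rename]

lemma nullSingletonClass_complexGaussian {v : ℝ≥0} (hv : 0 < v) :
    NullSingletonClass (complexGaussian v) := by
  have := nullSingletonClass_gaussianReal (μ := 0) (v := v / 2) (by positivity)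
  rw [complexGaussian_eq_map]
  refine ⟨fun x => ?_⟩
  rw [MeasurableEquiv.map_apply]
  have : Complex.measurableEquivRealProd.symm ⁻¹' {x} = {Complex.measurableEquivRealProd x} := by
    ext y
    rw [Set.mem_preimage, Set.mem_singleton_iff, Set.mem_singleton_iff,
      MeasurableEquiv.symm_apply_eq]
  rw [this]
  exact measure_singleton _

lemma pi_det_eq_zero {S : ℕ} (μ : Measure ℂ) [IsProbabilityMeasure μ] [NullSingletonClass μ] :
    (Measure.pi fun _ : Fin S × Fin S => μ)
      {x | (Matrix.of fun r s => x (r, s)).det = 0} = 0 := by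
  convert pi_eval_eq_zero μ _ (Matrix.det_mvPolynomialX_ne_zero (Fin S) ℂ) using 4 with x
  have hx : (Matrix.of fun r s => x (r, s)) =
      (MvPolynomial.eval x).mapMatrix (Matrix.mvPolynomialX (Fin S) (Fin S) ℂ) := by
    ext r s
    simp [Matrix.mvPolynomialX]
  rw [RingHom.map_det, hx]

/-- A circularly symmetric Gaussian variable hits small discs with a probability proportional to
their area. -/
lemma exists_complexGaussian_ball_ge {v : ℝ≥0} (hv : 0 < v) :
    ∃ c : ℝ, 0 < c ∧ ∀ r : ℝ, 0 ≤ r → r ≤ 1 →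
      ENNReal.ofReal (c * r) ≤ complexGaussian v {z | ‖z‖ ^ 2 ≤ r} := by
  have hv2 : v / 2 ≠ 0 := by positivity
  set m := gaussianPDFReal 0 (v / 2) 1 with hm
  have hm0 : 0 < m := gaussianPDFReal_pos _ _ _ hv2
  have hint : ∀ t : ℝ, 0 ≤ t → t ≤ 1 →
      ENNReal.ofReal (m * t) ≤ gaussianReal 0 (v / 2) (Set.Icc (-t) t) := by
    intro t ht0 ht1
    rw [gaussianReal_apply _ hv2]
    calc ENNReal.ofReal (m * t) ≤ ENNReal.ofReal m * volume (Set.Icc (-t) t) := by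
          rw [Real.volume_Icc, ← ENNReal.ofReal_mul hm0.le]
          exact ENNReal.ofReal_le_ofReal (by nlinarith)
      _ = ∫⁻ x in Set.Icc (-t) t, ENNReal.ofReal m := by simp
      _ ≤ _ := by
          refine setLIntegral_mono (measurable_gaussianPDF _ _) fun x hx => ?_
          refine ENNReal.ofReal_le_ofReal ?_
          rw [hm, gaussianPDFReal, gaussianPDFReal]
          gcongr ?_ * Real.exp ?_
          have : x ^ 2 ≤ 1 := by
            have := hx.1; have := hx.2; nlinarith
          simp only [sub_zero, one_pow]
          gcongr
  -- The square `[-t, t]²` with `t² = r/2` lies in the disc, and the real density is at least `m`,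
  -- its value at `1`, on `[-1, 1]`. Each side thus has mass at least `m * t`.
  refine ⟨m ^ 2 / 2, by positivity, fun r h0 h1 => ?_⟩
  set t := Real.sqrt (r / 2) with ht
  have ht0 : 0 ≤ t := Real.sqrt_nonneg _
  have hts : t ^ 2 = r / 2 := Real.sq_sqrt (by linarith)
  have ht1 : t ≤ 1 := by nlinarith
  rw [complexGaussian_eq_map, MeasurableEquiv.map_apply]
  calc ENNReal.ofReal (m ^ 2 / 2 * r) = ENNReal.ofReal (m * t) * ENNReal.ofReal (m * t) := by
        rw [← ENNReal.ofReal_mul (by positivity)]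
        congr 1
        linear_combination (-m ^ 2) * hts
    _ ≤ _ * _ := mul_le_mul' (hint t ht0 ht1) (hint t ht0 ht1)
    _ = _ := (Measure.prod_prod _ _).symm
    _ ≤ _ := by
        refine measure_mono fun p hp => ?_
        obtain ⟨⟨h1, h2⟩, h3, h4⟩ := hp
        simp only [Set.mem_preimage, Set.mem_ofPred_eq, Complex.sq_norm, Complex.normSq_apply]
        simp only [Complex.measurableEquivRealProd]
        simp
        nlinarith

/-! ### Optimal allocations within one cell. -/

lemma exists_finset_card_eq_forall_le {ι : Type*} [Fintype ι] (x : ι → ℝ) (S : ℕ)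
    (hS : S ≤ Fintype.card ι) :
    ∃ T : Finset ι, T.card = S ∧ ∀ p ∈ T, ∀ q ∉ T, x p ≤ x q := by
  classical
  induction S with
  | zero => exact ⟨∅, by simp, by simp⟩
  | succ S ih =>
    obtain ⟨T, hT, h⟩ := ih (by omega)
    have hne : Tᶜ.Nonempty := by
      rw [← Finset.card_pos, Finset.card_compl]
      omega
    obtain ⟨m, hm, hmin⟩ := Finset.exists_min_image Tᶜ x hne
    rw [Finset.mem_compl] at hm
    refine ⟨insert m T, by rw [Finset.card_insert_of_notMem hm, hT], fun p hp q hq => ?_⟩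
    simp only [Finset.mem_insert, not_or] at hp hq
    rcases hp with rfl | hp
    · exact hmin q (by simpa using hq.2)
    · exact h p hp q hq.2

namespace Allocation

variable {N L S : ℕ}

/-- The spatial channels with the smallest metrics in the cell form a feasible allocation. -/
lemma exists_isFeasible_totalLIF_eq {x : Fin N → Fin L → ℝ} (hx : ∀ j l, 0 ≤ x j l)
    (T : Finset (Fin N × Fin L)) (hT : T.card = S) (hS : 1 ≤ S)
    (hmin : ∀ p ∈ T, ∀ q ∉ T, x p.1 p.2 ≤ x q.1 q.2) :
    ∃ a : Allocation N L S, a.IsFeasible x ∧ a.totalLIF x = ∑ p ∈ T, x p.1 p.2 := by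
  classical
  let users : Finset (Fin N) := T.image Prod.fst
  -- Unselected users must choose antennas too. Giving them all antennas makes their sum-LIF as
  -- large as possible, so the user comparison follows from a termwise one.
  let antennas : Fin N → Finset (Fin L) := fun j =>
    if j ∈ users then Finset.univ.filter (fun l => (j, l) ∈ T) else Finset.univ
  have huse : ∀ p ∈ T, p.1 ∈ users := fun p hp => Finset.mem_image_of_mem _ hp
  have hant : ∀ j ∈ users, ∀ l, l ∈ antennas j ↔ (j, l) ∈ T := by
    intro j hj l
    simp [antennas, hj]
  have hant' : ∀ j ∉ users, antennas j = Finset.univ := by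
    intro j hj
    simp [antennas, hj]
  have hmem : ∀ p, p ∈ T ↔ p.1 ∈ users ∧ p.2 ∈ antennas p.1 := fun p =>
    ⟨fun h => ⟨huse p h, (hant _ (huse p h) _).2 h⟩, fun h => (hant _ h.1 _).1 h.2⟩
  have hsum : ∀ f : Fin N × Fin L → ℝ,
      ∑ p ∈ T, f p = ∑ j ∈ users, ∑ l ∈ antennas j, f (j, l) :=
    fun f => Finset.sum_finset_product T users antennas hmem
  let e := T.equivFinOfCardEq hT
  let a : Allocation N L S := ⟨antennas, users, fun s => (e.symm s).1⟩
  refine ⟨a, ⟨?_, ?_, ?_, ?_, ?_⟩, ?_⟩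
  · intro j
    change 1 ≤ (antennas j).card
    by_cases hj : j ∈ users
    · obtain ⟨p, hp, rfl⟩ := Finset.mem_image.1 hj
      exact Finset.card_pos.2 ⟨p.2, (hant _ hj _).2 hp⟩
    · rw [hant' j hj]
      obtain ⟨p, -⟩ := Finset.card_pos.1 (by omega : 0 < T.card)
      exact Finset.card_pos.2 ⟨p.2, Finset.mem_univ _⟩
  · intro j l hl l' hl'
    change l ∈ antennas j at hl
    change l' ∉ antennas j at hl'
    by_cases hj : j ∈ users
    · rw [hant j hj] at hl hl'
      exact hmin _ hl _ hl'
    · rw [hant' j hj] at hl'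
      simp at hl'
  · intro j hj j' hj'
    change j ∈ users at hj
    change j' ∉ users at hj'
    change ∑ l ∈ antennas j, x j l ≤ ∑ l ∈ antennas j', x j' l
    rw [hant' j' hj']
    calc ∑ l ∈ antennas j, x j l ≤ ∑ l ∈ antennas j, x j' l :=
          Finset.sum_le_sum fun l hl =>
            hmin (j, l) ((hant j hj l).1 hl) (j', l) fun h => hj' (huse _ h)
      _ ≤ ∑ l, x j' l :=
          Finset.sum_le_sum_of_subset_of_nonneg (Finset.subset_univ _) fun l _ _ => hx j' l
  · change ∑ j ∈ users, (antennas j).card = S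
    have := hsum fun _ => 1
    simp only [Finset.sum_const, nsmul_eq_mul, mul_one, hT] at this
    exact_mod_cast this.symm
  · have : {p : Fin N × Fin L | p.1 ∈ a.users ∧ p.2 ∈ a.antennas p.1} = T := by
      ext p
      exact (hmem p).symm
    rw [this]
    refine ⟨fun s _ => (e.symm s).2, fun s _ s' _ h => e.symm.injective (Subtype.ext h), ?_⟩
    intro p hp
    exact ⟨e ⟨p, hp⟩, trivial, by simp [a]⟩
  · exact (hsum fun p => x p.1 p.2).symm

lemma IsFeasible.sum_stream {x : Fin N → Fin L → ℝ} {a : Allocation N L S} (ha : a.IsFeasible x) :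
    ∑ s, x (a.stream s).1 (a.stream s).2 = a.totalLIF x := by
  classical
  have hinj : Function.Injective a.stream := Set.injOn_univ.1 ha.stream_bijOn.injOn
  have h := Finset.sum_finset_product (f := fun p : Fin N × Fin L => x p.1 p.2)
    (Finset.univ.image a.stream) a.users a.antennas fun p => by
      have := Set.ext_iff.1 ha.stream_bijOn.image_eq p
      simpa using this
  rw [Finset.sum_image hinj.injOn] at h
  exact h

lemma IsFeasible.stream_injective {x : Fin N → Fin L → ℝ} {a : Allocation N L S}
    (ha : a.IsFeasible x) : Function.Injective a.stream :=
  Set.injOn_univ.1 ha.stream_bijOn.injOn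

/-- If at least `S` antennas of the cell have a small metric, so have the antennas selected by an
optimal allocation. -/
lemma IsOptimal.stream_le {x : Fin N → Fin L → ℝ} (hx : ∀ j l, 0 ≤ x j l)
    {a : Allocation N L S} (ha : a.IsOptimal x) (hS : 1 ≤ S) {δ : ℝ}
    (hcard : S ≤ (Finset.univ.filter fun p : Fin N × Fin L => x p.1 p.2 ≤ δ).card) (s : Fin S) :
    x (a.stream s).1 (a.stream s).2 ≤ S * δ := by
  classical
  obtain ⟨T, hT, hmin⟩ := exists_finset_card_eq_forall_le
    (fun p : Fin N × Fin L => x p.1 p.2) S (hcard.trans (Finset.card_le_univ _))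
  obtain ⟨b, hb, hbT⟩ := exists_isFeasible_totalLIF_eq hx T hT hS hmin
  have hTδ : ∀ p ∈ T, x p.1 p.2 ≤ δ := by
    by_contra! hcon
    obtain ⟨p, hp, hpδ⟩ := hcon
    -- If a member of `T` exceeded `δ`, the at least `S` antennas below `δ` would all lie in the
    -- remaining `S - 1` members.
    have hsub : (Finset.univ.filter fun p : Fin N × Fin L => x p.1 p.2 ≤ δ) ⊆ T.erase p := by
      intro q hq
      simp only [Finset.mem_filter, Finset.mem_univ, true_and] at hq
      rw [Finset.mem_erase]
      refine ⟨fun h => by rw [h] at hq; linarith, ?_⟩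
      by_contra hqT
      have := hmin p hp q hqT
      linarith
    have := Finset.card_le_card hsub
    rw [Finset.card_erase_of_mem hp] at this
    omega
  calc x (a.stream s).1 (a.stream s).2 ≤ ∑ s, x (a.stream s).1 (a.stream s).2 :=
        Finset.single_le_sum (f := fun s => x (a.stream s).1 (a.stream s).2)
          (fun s _ => hx _ _) (Finset.mem_univ s)
    _ = a.totalLIF x := ha.1.sum_stream
    _ ≤ b.totalLIF x := ha.2 b hb
    _ = ∑ p ∈ T, x p.1 p.2 := hbT
    _ ≤ ∑ p ∈ T, δ := Finset.sum_le_sum hTδ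
    _ = S * δ := by simp [hT]

end Allocation

/-! ### Deterministic bounds on interference and rates. -/

section Rate

variable {K N M L S : ℕ} {U : Fin K → Matrix (Fin M) (Fin S) ℂ} {H : Channel K N M L}
  {a : Fin K → Allocation N L S} {i : Fin K} {s : Fin S} {snr δ : ℝ}

lemma lif_nonneg (i : Fin K) (j : Fin N) (l : Fin L) : 0 ≤ lif U H i j l :=
  Finset.sum_nonneg fun _ _ => sq_nonneg _

lemma interference_nonneg (h : 0 ≤ snr) : 0 ≤ interference snr U H a i s :=
  Finset.sum_nonneg fun _ _ => Finset.sum_nonneg fun _ _ => mul_nonneg (sq_nonneg _) h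

/-- Cauchy–Schwarz, together with the fact that the metric of a stream of cell `k ≠ i` contains its
leakage at BS `i` as one nonnegative term. The factor `K` overcounts the `K - 1` interfering cells.
-/
lemma interference_le (hsnr : 0 ≤ snr)
    (h : ∀ k m, lif U H k ((a k).stream m).1 ((a k).stream m).2 ≤ δ) :
    interference snr U H a i s ≤ K * S * (‖zfVector U H a i s‖ ^ 2 * δ * snr) := by
  have hδ : 0 ≤ δ := (lif_nonneg _ _ _).trans (h i s)
  have hterm : ∀ k ∈ Finset.univ.filter (fun k => k ≠ i), ∀ m : Fin S,
      ‖inner ℂ (zfVector U H a i s) (effectiveChannel U H a i k m)‖ ^ 2 * snr ≤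
        ‖zfVector U H a i s‖ ^ 2 * δ * snr := by
    intro k hk m
    have hle : ‖effectiveChannel U H a i k m‖ ^ 2 ≤ δ := by
      refine le_trans ?_ (h k m)
      refine Finset.single_le_sum
        (f := fun k' => ‖projectedChannel U H k' k ((a k).stream m).1 ((a k).stream m).2‖ ^ 2)
        (fun _ _ => sq_nonneg _) (Finset.mem_filter.2 ⟨Finset.mem_univ i, ?_⟩)
      exact fun hik => (Finset.mem_filter.1 hk).2 hik.symm
    refine mul_le_mul_of_nonneg_right ?_ hsnr
    calc ‖inner ℂ (zfVector U H a i s) (effectiveChannel U H a i k m)‖ ^ 2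
        ≤ (‖zfVector U H a i s‖ * ‖effectiveChannel U H a i k m‖) ^ 2 := by
          gcongr
          exact norm_inner_le_norm _ _
      _ = ‖zfVector U H a i s‖ ^ 2 * ‖effectiveChannel U H a i k m‖ ^ 2 := mul_pow _ _ _
      _ ≤ _ := by gcongr
  have hpos : 0 ≤ ‖zfVector U H a i s‖ ^ 2 * δ * snr := by positivity
  calc interference snr U H a i s
      ≤ ∑ k ∈ Finset.univ.filter (fun k => k ≠ i), ∑ m : Fin S,
          ‖zfVector U H a i s‖ ^ 2 * δ * snr :=
        Finset.sum_le_sum fun k hk => Finset.sum_le_sum fun m _ => hterm k hk m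
    _ ≤ ∑ k : Fin K, ∑ m : Fin S, ‖zfVector U H a i s‖ ^ 2 * δ * snr :=
        Finset.sum_le_sum_of_subset_of_nonneg (Finset.subset_univ _)
          fun _ _ _ => Finset.sum_nonneg fun _ _ => hpos
    _ = _ := by simp; ring

/-- The rate of a stream stays within a constant of `log snr` when the equalizer is bounded above
and below and the leakage of the selected antennas is `O(1 / snr)`. -/
lemma abs_streamRate_sub_log_le (hsnr : 1 ≤ snr) {b B : ℝ} (hb : 0 < b) (hB : 1 ≤ B)
    (hfb : b ≤ ‖zfVector U H a i s‖ ^ 2) (hfB : ‖zfVector U H a i s‖ ^ 2 ≤ B)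
    (h : ∀ k m, lif U H k ((a k).stream m).1 ((a k).stream m).2 ≤ S * (1 / snr)) :
    |streamRate snr U H a i s - Real.log snr| ≤
      Real.log (1 + 1 / b) + Real.log (B * (1 + K * S * S)) := by
  have hsnr0 : 0 < snr := by linarith
  have hI0 : 0 ≤ interference snr U H a i s := interference_nonneg hsnr0.le
  have hI := interference_le (i := i) (s := s) hsnr0.le h
  set f := ‖zfVector U H a i s‖ ^ 2 with hf
  -- The leakage bound `S / snr` cancels the transmit power, so the SNR disappears.
  have hI' : interference snr U H a i s ≤ f * (K * S * S) := by
    refine hI.trans (le_of_eq ?_)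
    field_simp
  have hC : (0 : ℝ) ≤ K * S * S := by positivity
  have hf0 : 0 < f := hb.trans_le hfb
  have hden : 0 < f + interference snr U H a i s := by linarith
  have h1 : 0 ≤ Real.log (1 + 1 / b) := Real.log_nonneg (by
    have : 0 < 1 / b := by positivity
    linarith)
  have h2 : 0 ≤ Real.log (B * (1 + K * S * S)) := Real.log_nonneg (by nlinarith)
  have hq : 0 < snr / (f + interference snr U H a i s) := by positivity
  rw [streamRate, ← hf, abs_le]
  constructor
  · have : Real.log (snr / (B * (1 + K * S * S))) ≤
        Real.log (1 + snr / (f + interference snr U H a i s)) := by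
      refine Real.log_le_log (by positivity) ?_
      have : snr / (B * (1 + K * S * S)) ≤ snr / (f + interference snr U H a i s) := by
        refine div_le_div_of_nonneg_left hsnr0.le hden ?_
        nlinarith
      linarith
    rw [Real.log_div (by positivity) (by positivity)] at this
    linarith
  -- Interference is dropped here, and `1 ≤ snr` absorbs the summand `1` in the logarithm.
  · have : Real.log (1 + snr / (f + interference snr U H a i s)) ≤
        Real.log (snr * (1 + 1 / b)) := by
      refine Real.log_le_log (by positivity) ?_
      have : snr / (f + interference snr U H a i s) ≤ snr / b :=
        div_le_div_of_nonneg_left hsnr0.le hb (by linarith)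
      have e : snr * (1 + 1 / b) = snr + snr / b := by ring
      linarith
    rw [Real.log_mul (by positivity) (by positivity)] at this
    linarith

lemma abs_sumRate_sub_log_le (hsnr : 1 ≤ snr) {b B : ℝ} (hb : 0 < b) (hB : 1 ≤ B)
    (hf : ∀ i s, b ≤ ‖zfVector U H a i s‖ ^ 2 ∧ ‖zfVector U H a i s‖ ^ 2 ≤ B)
    (h : ∀ k m, lif U H k ((a k).stream m).1 ((a k).stream m).2 ≤ S * (1 / snr)) :
    |sumRate snr U H a - K * S * Real.log snr| ≤
      K * S * (Real.log (1 + 1 / b) + Real.log (B * (1 + K * S * S))) := by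
  have e : sumRate snr U H a - K * S * Real.log snr =
      ∑ i : Fin K, ∑ s : Fin S, (streamRate snr U H a i s - Real.log snr) := by
    simp [sumRate, Finset.sum_sub_distrib]
    ring
  rw [e]
  calc _ ≤ ∑ i : Fin K, ∑ s : Fin S, |streamRate snr U H a i s - Real.log snr| :=
        (Finset.abs_sum_le_sum_abs _ _).trans
          (Finset.sum_le_sum fun _ _ => Finset.abs_sum_le_sum_abs _ _)
    _ ≤ ∑ i : Fin K, ∑ s : Fin S, (Real.log (1 + 1 / b) + Real.log (B * (1 + K * S * S))) :=
        Finset.sum_le_sum fun i _ => Finset.sum_le_sum fun s _ =>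
          abs_streamRate_sub_log_le hsnr hb hB (hf i s).1 (hf i s).2 h
    _ = _ := by simp; ring

end Rate

/-! ### Reduction to i.i.d. projected channels. -/

/-- The projected channel vectors `U_kᴴ h_{k,l}^{[i,j]}`, as a family of complex numbers. -/
noncomputable def projectedTable {K N M L S : ℕ} (U : Fin K → Matrix (Fin M) (Fin S) ℂ)
    (H : Channel K N M L) : Fin S × (Fin K × Fin K × Fin N × Fin L) → ℂ :=
  fun e => projectedChannel U H e.2.1 e.2.2.1 e.2.2.2.1 e.2.2.2.2 e.1

/-- A family of projected channels, as the channel of a network in which the base stations have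
`S` antennas. -/
def tableChannel {K N L S : ℕ} (g : Fin S × (Fin K × Fin K × Fin N × Fin L) → ℂ) :
    Channel K N S L :=
  fun k i j r l => g (r, (k, i, j, l))

/-- The reference bases of a network in which the base stations have `S` antennas. -/
abbrev trivialBases (K S : ℕ) : Fin K → Matrix (Fin S) (Fin S) ℂ := fun _ => 1

section Table

variable {K N M L S : ℕ}

lemma projectedChannel_tableChannel (g : Fin S × (Fin K × Fin K × Fin N × Fin L) → ℂ)
    (k i : Fin K) (j : Fin N) (l : Fin L) :
    projectedChannel (trivialBases K S) (tableChannel g) k i j l =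
      WithLp.toLp 2 fun r => g (r, (k, i, j, l)) := by
  simp [projectedChannel, tableChannel]

/-- Metrics, equalizers and rates depend on `U` and `H` only through `projectedChannel`, so this
identity transfers all of them to identity bases. -/
lemma projectedChannel_projectedTable (U : Fin K → Matrix (Fin M) (Fin S) ℂ)
    (H : Channel K N M L) :
    projectedChannel (trivialBases K S) (tableChannel (projectedTable U H)) = projectedChannel U H := by
  funext k i j l
  rw [projectedChannel_tableChannel]
  rfl

lemma lif_projectedTable (U : Fin K → Matrix (Fin M) (Fin S) ℂ) (H : Channel K N M L) :
    lif (trivialBases K S) (tableChannel (projectedTable U H)) = lif U H := by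
  unfold lif
  rw [projectedChannel_projectedTable]

lemma sumRate_projectedTable (snr : ℝ) (U : Fin K → Matrix (Fin M) (Fin S) ℂ)
    (H : Channel K N M L) (a : Fin K → Allocation N L S) :
    sumRate snr (trivialBases K S) (tableChannel (projectedTable U H)) a = sumRate snr U H a := by
  unfold sumRate streamRate interference zfVector zfEqualizer effectiveChannel
  rw [projectedChannel_projectedTable]

lemma lif_tableChannel (g : Fin S × (Fin K × Fin K × Fin N × Fin L) → ℂ)
    (i : Fin K) (j : Fin N) (l : Fin L) :
    lif (trivialBases K S) (tableChannel g) i j l =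
      ∑ k ∈ Finset.univ.filter (fun k => k ≠ i), ∑ r, ‖g (r, (k, i, j, l))‖ ^ 2 := by
  unfold lif
  simp_rw [projectedChannel_tableChannel, EuclideanSpace.norm_sq_eq]

lemma measurable_lif_tableChannel (i : Fin K) :
    Measurable fun g : Fin S × (Fin K × Fin K × Fin N × Fin L) → ℂ =>
      lif (trivialBases K S) (tableChannel g) i := by
  refine measurable_pi_lambda _ fun j => measurable_pi_lambda _ fun l => ?_
  simp_rw [lif_tableChannel]
  fun_prop

/-- One block per channel vector: blocks may repeat, yet the whole matrix has orthonormal rows, so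
all projections are treated jointly. -/
lemma map_blockDiagonal_mulVec_pi_complexGaussian {o m n : Type*} [Fintype o] [DecidableEq o]
    [Fintype m] [Fintype n] [DecidableEq n] (v : ℝ≥0) (u : o → Matrix m n ℂ)
    (hu : ∀ i, (u i)ᴴ * u i = 1) :
    (Measure.pi fun _ : m × o => complexGaussian v).map
        (fun x => Matrix.blockDiagonal (fun i => (u i)ᴴ) *ᵥ x) =
      Measure.pi fun _ : n × o => complexGaussian v := by
  refine map_mulVec_pi_complexGaussian v _ ?_
  rw [Matrix.blockDiagonal_conjTranspose, ← Matrix.blockDiagonal_mul]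
  simp_rw [Matrix.conjTranspose_conjTranspose, hu]
  exact Matrix.blockDiagonal_one

/-- If `Φ (u, ·)` maps `μ` to `ν` for almost every value `u` of `U`, and `V` has law `μ` and is
independent of `U`, then `Φ (U, V)` has law `ν`. -/
lemma hasLaw_of_indepFun_of_ae_map_eq {Ω α β δ : Type*} [MeasurableSpace Ω] [MeasurableSpace α]
    [MeasurableSpace β] [MeasurableSpace δ] {P : Measure Ω} [IsProbabilityMeasure P]
    {U : Ω → α} {V : Ω → β} {μ : Measure β} [SFinite μ] {ν : Measure δ} {Φ : α × β → δ}
    (hΦ : Measurable Φ) (hU : Measurable U) (hV : HasLaw V μ P) (hUV : IndepFun U V P)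
    (h : ∀ᵐ u ∂(P.map U), μ.map (fun y => Φ (u, y)) = ν) :
    HasLaw (fun ω => Φ (U ω, V ω)) ν P := by
  have : IsProbabilityMeasure (P.map U) := Measure.isProbabilityMeasure_map hU.aemeasurable
  have hjoint : HasLaw (fun ω => (U ω, V ω)) ((P.map U).prod μ) P :=
    IndepFun.hasLaw_prod ⟨hU.aemeasurable, rfl⟩ hV hUV
  refine ⟨hΦ.comp_aemeasurable hjoint.aemeasurable, ?_⟩
  rw [← Function.comp_def Φ, ← AEMeasurable.map_map_of_aemeasurable hΦ.aemeasurable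
    hjoint.aemeasurable, hjoint.map_eq]
  ext A hA
  rw [Measure.map_apply hΦ hA, Measure.prod_apply (hΦ hA)]
  have hae : ∀ᵐ u ∂(P.map U), μ (Prod.mk u ⁻¹' (Φ ⁻¹' A)) = ν A := by
    filter_upwards [h] with u hu
    have hm : Measurable fun y => Φ (u, y) := hΦ.comp measurable_prodMk_left
    rw [← hu, Measure.map_apply hm hA]
    rfl
  rw [lintegral_congr_ae hae]
  simp

/-- The projected channels are i.i.d. complex Gaussian, for any random reference bases which are
independent of the channels. -/
lemma hasLaw_projectedTable {Ω : Type*} [MeasurableSpace Ω] {P : Measure Ω}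
    [IsProbabilityMeasure P] {U : Ω → Fin K → Matrix (Fin M) (Fin S) ℂ}
    (hUo : ∀ ω k, (U ω k)ᴴ * U ω k = 1) (hU : ∀ k m s, Measurable (fun ω => U ω k m s))
    {v : ℝ≥0} {H : Ω → Channel K N M L} (hH : IsGaussianChannel P v H)
    (hUH : IndepFun (fun ω k m s => U ω k m s) (fun ω k i j m l => H ω k i j m l) P) :
    HasLaw (fun ω => projectedTable (U ω) (H ω)) (Measure.pi fun _ => complexGaussian v) P := by
  let X := Fin K × Fin K × Fin N × Fin L
  let Hv : Ω → Fin M × X → ℂ := fun ω e => H ω e.2.1 e.2.2.1 e.2.2.2.1 e.1 e.2.2.2.2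
  let Uv : Ω → Fin K → Fin M → Fin S → ℂ := fun ω k m s => U ω k m s
  let Φ : (Fin K → Fin M → Fin S → ℂ) × (Fin M × X → ℂ) → Fin S × X → ℂ := fun p =>
    Matrix.blockDiagonal (fun o : X => (Matrix.of (p.1 o.1))ᴴ) *ᵥ p.2
  have hΦ : Measurable Φ := by
    refine Continuous.measurable ?_
    refine Continuous.matrix_mulVec (Continuous.matrix_blockDiagonal ?_) continuous_snd
    refine continuous_pi fun o => Continuous.matrix_conjTranspose ?_
    exact (continuous_apply o.1).comp continuous_fst
  have hUv : Measurable Uv :=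
    measurable_pi_lambda _ fun k => measurable_pi_lambda _ fun m => measurable_pi_lambda _ fun s =>
      hU k m s
  have hlawH : HasLaw Hv (Measure.pi fun _ => complexGaussian v) P := by
    refine iIndepFun.hasLaw_pi (fun e => hH.hasLaw _ _ _ _ _) ?_
    refine hH.indep.precomp (g := fun e : Fin M × X => (e.2.1, e.2.2.1, e.2.2.2.1, e.1, e.2.2.2.2))
      ?_
    rintro ⟨m, k, i, j, l⟩ ⟨m', k', i', j', l'⟩ h
    simp only [Prod.mk.injEq] at h ⊢
    obtain ⟨rfl, rfl, rfl, rfl, rfl⟩ := h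
    exact ⟨rfl, rfl⟩
  have hind : IndepFun Uv Hv P := by
    refine hUH.comp (φ := id) (ψ := fun h (e : Fin M × X) =>
      h e.2.1 e.2.2.1 e.2.2.2.1 e.1 e.2.2.2.2) measurable_id ?_
    fun_prop
  have heq : (fun ω => projectedTable (U ω) (H ω)) = fun ω => Φ (Uv ω, Hv ω) := by
    funext ω e
    obtain ⟨s, o⟩ := e
    simp only [projectedTable, projectedChannel, Φ, Matrix.mulVec, dotProduct,
      Fintype.sum_prod_type, Matrix.blockDiagonal_apply]
    simp [Uv, Hv]
  rw [heq]
  refine hasLaw_of_indepFun_of_ae_map_eq hΦ hUv hlawH hind ?_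
  -- Orthonormality is a closed condition, so it passes from the sample points to the law of the
  -- bases.
  have hae : ∀ᵐ u ∂(P.map Uv), ∀ k, (Matrix.of (u k))ᴴ * Matrix.of (u k) = 1 := by
    rw [ae_map_iff hUv.aemeasurable]
    · exact ae_of_all _ hUo
    · simp only [Set.ofPred_forall]
      refine (isClosed_iInter fun k => isClosed_eq ?_ continuous_const).measurableSet
      exact ((Continuous.matrix_conjTranspose (continuous_apply k)).matrix_mul
        (continuous_apply k))
  filter_upwards [hae] with u hu
  exact map_blockDiagonal_mulVec_pi_complexGaussian v (fun o : X => Matrix.of (u o.1))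
    fun o => hu o.1

end Table

/-! ### Counting independent rare events. -/

section Count

/-- Chernoff's bound for the number of independent events that occur. -/
lemma measureReal_card_le_le {Ω ι : Type*} [MeasurableSpace Ω] {μ : Measure Ω}
    [IsProbabilityMeasure μ] [Fintype ι] {E : ι → Set Ω} (hE : ∀ i, MeasurableSet (E i))
    (hind : iIndepSet E μ) {q : ℝ} (hq : ∀ i, q ≤ μ.real (E i)) (S : ℕ)
    [∀ ω, DecidablePred (ω ∈ E ·)] :
    μ.real {ω | (Finset.univ.filter fun i => ω ∈ E i).card ≤ S} ≤
      Real.exp S * Real.exp (-(Fintype.card ι * q * (1 - Real.exp (-1)))) := by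
  have he : 0 < 1 - Real.exp (-1) := by
    have := Real.exp_lt_one_iff.2 (show (-1 : ℝ) < 0 by norm_num)
    linarith
  let X : ι → Ω → ℝ := fun i => (E i).indicator fun _ => 1
  have hX : ∀ i, Measurable (X i) := fun i => measurable_const.indicator (hE i)
  have hindX : iIndepFun X μ := hind.iIndepFun_indicator
  have hsum : ∀ ω, (∑ i, X i) ω = ((Finset.univ.filter fun i => ω ∈ E i).card : ℝ) := by
    intro ω
    simp [X, Finset.sum_apply, Set.indicator_apply]
  -- The exponential moment is `1 - p(1 - e⁻¹)` with `p` the probability of the event; then `1 - x ≤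
  -- exp (-x)`.
  have hmgf : ∀ i, mgf (X i) μ (-1) ≤ Real.exp (-(q * (1 - Real.exp (-1)))) := by
    intro i
    have hfun : (fun ω => Real.exp (-1 * X i ω)) =
        fun ω => 1 - (E i).indicator (fun _ => 1 - Real.exp (-1)) ω := by
      funext ω
      by_cases h : ω ∈ E i <;> simp [X, h]
    rw [mgf, hfun, integral_sub (integrable_const _) ((integrable_const _).indicator (hE i)),
      integral_indicator_const _ (hE i)]
    simp only [integral_const, probReal_univ, smul_eq_mul, one_mul]
    have h1 : q * (1 - Real.exp (-1)) ≤ μ.real (E i) * (1 - Real.exp (-1)) :=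
      mul_le_mul_of_nonneg_right (hq i) he.le
    have h2 := Real.add_one_le_exp (-(q * (1 - Real.exp (-1))))
    linarith
  have hint : Integrable (fun ω => Real.exp (-1 * (∑ i, X i) ω)) μ := by
    refine Integrable.of_bound (C := 1) ?_ (ae_of_all _ fun ω => ?_)
    · have hm : Measurable (∑ i, X i) := by fun_prop
      exact (hm.const_mul (-1)).exp.aestronglyMeasurable
    · rw [Real.norm_eq_abs, abs_of_pos (Real.exp_pos _), Real.exp_le_one_iff, hsum]
      have : (0 : ℝ) ≤ ((Finset.univ.filter fun i => ω ∈ E i).card : ℝ) := by positivity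
      linarith
  have hch := measure_le_le_exp_mul_mgf (μ := μ) (X := ∑ i, X i) (t := -1) (S : ℝ) (by norm_num) hint
  rw [hindX.mgf_sum hX] at hch
  have hset : {ω | (Finset.univ.filter fun i => ω ∈ E i).card ≤ S} =
      {ω | (∑ i, X i) ω ≤ (S : ℝ)} := by
    ext ω
    simp only [Set.mem_ofPred_eq, hsum, Nat.cast_le]
  rw [hset]
  refine hch.trans ?_
  rw [neg_neg, one_mul]
  gcongr
  calc ∏ i, mgf (X i) μ (-1) ≤ ∏ _i : ι, Real.exp (-(q * (1 - Real.exp (-1)))) :=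
        Finset.prod_le_prod (fun _ _ => mgf_nonneg) fun i _ => hmgf i
    _ = _ := by
        rw [Finset.prod_const, ← Real.exp_nat_mul, Finset.card_univ]
        congr 1
        ring

/-- Injectivity of `f` makes distinct `p` read disjoint sets of coordinates. The product formula
over every `T` is the one that `iIndepSet` requires. -/
lemma measure_biInter_forall_mem {ι κ Δ : Type*} [Fintype ι] [Fintype Δ] (μ : Measure ℂ)
    [IsProbabilityMeasure μ] {f : κ × Δ → ι} (hf : Function.Injective f) {B : Set ℂ}
    (hB : MeasurableSet B) (T : Finset κ) :
    (Measure.pi fun _ : ι => μ) (⋂ p ∈ T, {g | ∀ d, g (f (p, d)) ∈ B}) =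
      ∏ _p ∈ T, μ B ^ Fintype.card Δ := by
  have hind : iIndepFun (fun (e : ι) (g : ι → ℂ) => g e) (Measure.pi fun _ : ι => μ) :=
    iIndepFun_pi (X := fun _ x => x) fun _ => aemeasurable_id
  have h := (hind.precomp hf).measure_inter_preimage_eq_mul (T ×ˢ Finset.univ)
    (sets := fun _ => B) fun _ _ => hB
  have hset : (⋂ p ∈ T, {g : ι → ℂ | ∀ d, g (f (p, d)) ∈ B}) =
      ⋂ e ∈ T ×ˢ (Finset.univ : Finset Δ), (fun g : ι → ℂ => g (f e)) ⁻¹' B := by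
    ext g
    simp only [Set.mem_iInter, Set.mem_ofPred_eq, Finset.mem_product, Finset.mem_univ, and_true,
      Set.mem_preimage]
    exact ⟨fun h e he => h e.1 he e.2, fun h p hp d => h (p, d) hp⟩
  rw [hset]
  refine h.trans ?_
  have hev : ∀ e : ι, (Measure.pi fun _ : ι => μ) ((fun g => g e) ⁻¹' B) = μ B := fun e =>
    (measurePreserving_eval (fun _ : ι => μ) e).measure_preimage hB.nullMeasurableSet
  simp_rw [hev]
  rw [Finset.prod_product]
  simp

end Count

/-! ### Independence of the selection from the own channels. -/

/-- If the event `C b` is independent of `φ = b` and has probability `c` for every value `b` of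
`φ`, then `C φ` has probability at most `c`. -/
lemma measure_mem_apply_le_of_inter_eq_mul {α β : Type*} [MeasurableSpace α] [Countable β]
    {γ : Measure α} [IsProbabilityMeasure γ] {φ : α → β} (hφ : ∀ b, MeasurableSet {g | φ g = b})
    {C : β → Set α} {c : ENNReal} (h : ∀ b, γ ({g | φ g = b} ∩ C b) = γ {g | φ g = b} * c) :
    γ {g | g ∈ C (φ g)} ≤ c :=
  calc γ {g | g ∈ C (φ g)}
      ≤ γ (⋃ b, {g | φ g = b} ∩ C b) :=
        measure_mono fun g hg => Set.mem_iUnion.2 ⟨φ g, rfl, hg⟩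
    _ ≤ ∑' b, γ ({g | φ g = b} ∩ C b) := measure_iUnion_le _
    _ = (∑' b, γ {g | φ g = b}) * c := by
        simp_rw [h, ENNReal.tsum_mul_right]
    _ = γ (⋃ b, {g | φ g = b}) * c := by
        rw [measure_iUnion _ hφ]
        intro a b hab
        rw [Function.onFun, Set.disjoint_left]
        rintro g rfl hb
        exact hab hb
    _ ≤ 1 * c := by
        gcongr
        exact prob_le_one
    _ = _ := one_mul _

/-- `A` is determined by the coordinates satisfying `p`, while `f` reads only other coordinates;
under a product measure these two groups are independent. -/
lemma measure_inter_preimage_comp_eq_mul {ι κ : Type*} [Fintype ι] [Fintype κ] (μ : Measure ℂ)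
    [IsProbabilityMeasure μ] (p : ι → Prop) {A : Set (ι → ℂ)} (hA : MeasurableSet A)
    (hAp : ∀ g g' : ι → ℂ, (∀ e, p e → g e = g' e) → g ∈ A → g' ∈ A) {f : κ → ι}
    (hf : Function.Injective f) (hfp : ∀ k, ¬ p (f k)) {B : Set (κ → ℂ)} (hB : MeasurableSet B) :
    (Measure.pi fun _ : ι => μ) (A ∩ {g | g ∘ f ∈ B}) =
      (Measure.pi fun _ : ι => μ) A * (Measure.pi fun _ : κ => μ) B := by
  classical
  set γ : Measure (ι → ℂ) := Measure.pi fun _ => μ with hγ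
  have hind : iIndepFun (fun (e : ι) (g : ι → ℂ) => g e) γ :=
    iIndepFun_pi (X := fun _ x => x) fun _ => aemeasurable_id
  let T : Finset ι := Finset.univ.filter p
  -- Padding by `0` is harmless, since membership in `A` ignores the coordinates outside `T`.
  let ext₁ : (T → ℂ) → ι → ℂ := fun h e => if he : e ∈ T then h ⟨e, he⟩ else 0
  have hext : Measurable ext₁ := by
    refine measurable_pi_lambda _ fun e => ?_
    by_cases he : e ∈ T
    · simp only [ext₁, he, dif_pos]
      exact measurable_pi_apply _
    · simp only [ext₁, he, dif_neg, not_false_eq_true]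
      exact measurable_const
  let F : Finset ι := Tᶜ
  have hfF : ∀ k, f k ∈ F := fun k => by simpa [F, T] using hfp k
  let res : (F → ℂ) → κ → ℂ := fun h k => h ⟨f k, hfF k⟩
  have hres : Measurable res := measurable_pi_lambda _ fun e => measurable_pi_apply _
  have h := (hind.indepFun_finset T F disjoint_compl_right
    (fun e => measurable_pi_apply e)).measure_inter_preimage_eq_mul (ext₁ ⁻¹' A) (res ⁻¹' B)
    (hext hA) (hres hB)
  have e1 : (fun (g : ι → ℂ) (e : T) => g e) ⁻¹' (ext₁ ⁻¹' A) = A := by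
    ext g
    have hg : ∀ e, p e → ext₁ (fun e : T => g e) e = g e := fun e he => by
      simp [ext₁, T, he]
    exact ⟨hAp _ _ hg, hAp _ _ fun e he => (hg e he).symm⟩
  have e2 : (fun (g : ι → ℂ) (e : F) => g e) ⁻¹' (res ⁻¹' B) = {g | g ∘ f ∈ B} := rfl
  rw [e1, e2] at h
  rw [h]
  congr 1
  have hlaw := iIndepFun.hasLaw_pi (P := γ) (μ := fun _ => μ)
    (fun k : κ => (measurePreserving_eval (fun _ : ι => μ) (f k)).hasLaw) (hind.precomp hf)
  rw [← hlaw.map_eq, Measure.map_apply_of_aemeasurable hlaw.aemeasurable hB]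
  rfl

section Selection

variable {K N L S : ℕ}

instance : Countable (Allocation N L S) := by
  have : Function.Injective fun a : Allocation N L S => (a.antennas, a.users, a.stream) := by
    rintro ⟨_, _, _⟩ ⟨_, _, _⟩ h
    simp only [Prod.mk.injEq] at h
    obtain ⟨rfl, rfl, rfl⟩ := h
    rfl
  exact this.countable

/-- The entries of the effective channel matrix of cell `i` to its own base station. -/
def ownEntries (g : Fin S × (Fin K × Fin K × Fin N × Fin L) → ℂ) (i : Fin K)
    (a : Allocation N L S) : Fin S × Fin S → ℂ :=
  fun e => g (e.1, (i, i, a.stream e.2))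

/-- The selection of a cell does not depend on the channels within the cell, so the effective
channel matrix to the own base station has i.i.d. complex Gaussian entries. -/
lemma measure_ownEntries_le (μ : Measure ℂ) [IsProbabilityMeasure μ] (i : Fin K)
    {sel : (Fin N → Fin L → ℝ) → Allocation N L S} (hsel : IsGeneralSelectionRule sel)
    {B : Set (Fin S × Fin S → ℂ)} (hB : MeasurableSet B) :
    (Measure.pi fun _ => μ) {g : Fin S × (Fin K × Fin K × Fin N × Fin L) → ℂ |
      ownEntries g i (sel (lif (trivialBases K S) (tableChannel g) i)) ∈ B} ≤
      (Measure.pi fun _ => μ) B := by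
  set γ : Measure (Fin S × (Fin K × Fin K × Fin N × Fin L) → ℂ) := Measure.pi fun _ => μ
  let φ : (Fin S × (Fin K × Fin K × Fin N × Fin L) → ℂ) → Allocation N L S :=
    fun g => sel (lif (trivialBases K S) (tableChannel g) i)
  have hφ : ∀ a, MeasurableSet {g | φ g = a} := fun a =>
    (measurable_lif_tableChannel i) (hsel.measurable a)
  have hfactor : ∀ a, γ ({g | φ g = a} ∩ {g | ownEntries g i a ∈ B}) =
      γ {g | φ g = a} * (Measure.pi fun _ => μ) B := by
    intro a
    by_cases ha : Function.Injective a.stream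
    -- The metrics of cell `i` read only entries received at base stations other than `i`. An
    -- injective stream makes the own entries distinct coordinates.
    · refine measure_inter_preimage_comp_eq_mul μ (fun e => e.2.1 ≠ i) (hφ a) ?_
        (f := fun e => (e.1, (i, i, a.stream e.2))) ?_ (fun _ => not_not.2 rfl) hB
      · intro g g' hgg' hg
        have : lif (trivialBases K S) (tableChannel g') i =
            lif (trivialBases K S) (tableChannel g) i := by
          funext j l
          rw [lif_tableChannel, lif_tableChannel]
          refine Finset.sum_congr rfl fun k hk => Finset.sum_congr rfl fun r _ => ?_
          rw [hgg' _ (Finset.mem_filter.1 hk).2]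
        rw [Set.mem_ofPred_eq] at hg ⊢
        rw [← hg]
        exact congrArg sel this
      · rintro ⟨r, s⟩ ⟨r', s'⟩ hrs
        simp only [Prod.mk.injEq, true_and] at hrs ⊢
        exact ⟨hrs.1, ha hrs.2⟩
    -- A feasible allocation has an injective stream, so this value is never selected.
    · have : {g | φ g = a} = ∅ := by
        refine Set.eq_empty_of_forall_notMem fun g hg => ha ?_
        have := (hsel.optimal (lif (trivialBases K S) (tableChannel g) i)).1.stream_injective
        rwa [show sel (lif (trivialBases K S) (tableChannel g) i) = a from hg] at this
      simp [this]
  exact measure_mem_apply_le_of_inter_eq_mul hφ hfactor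

end Selection

/-! ### Abundance of antennas with small leakage. -/

section Leakage

variable {K N L S : ℕ}

/-- It is unlikely that fewer than `S` antennas of a cell have a small LIF metric. -/
lemma measure_card_lif_le_lt_le {v : ℝ≥0} {c : ℝ} (hc0 : 0 < c)
    (hc : ∀ r : ℝ, 0 ≤ r → r ≤ 1 → ENNReal.ofReal (c * r) ≤ complexGaussian v {z | ‖z‖ ^ 2 ≤ r})
    (i : Fin K) (hS : 1 ≤ S) {δ : ℝ} (hδ0 : 0 ≤ δ) (hδ1 : δ ≤ 1) :
    (Measure.pi fun _ => complexGaussian v)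
      {g : Fin S × (Fin K × Fin K × Fin N × Fin L) → ℂ |
        (Finset.univ.filter fun p : Fin N × Fin L =>
          lif (trivialBases K S) (tableChannel g) i p.1 p.2 ≤ δ).card < S} ≤
      ENNReal.ofReal (Real.exp S *
        Real.exp (-(N * L * (c * (δ / (K * S))) ^ ((K - 1) * S) * (1 - Real.exp (-1))))) := by
  classical
  set γ : Measure (Fin S × (Fin K × Fin K × Fin N × Fin L) → ℂ) :=
    Measure.pi fun _ => complexGaussian v with hγ
  have hK : 1 ≤ K := Fin.pos i
  have hKS : (1 : ℝ) ≤ K * S := by exact_mod_cast Nat.mul_pos hK hS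
  -- A metric sums `(K-1)S ≤ KS` squared moduli, so it is at most `δ` once each of them is at most
  -- `ρ`.
  set ρ := δ / (K * S) with hρ
  have hρ0 : 0 ≤ ρ := by positivity
  have hρ1 : ρ ≤ 1 := by
    rw [hρ, div_le_one (by linarith)]
    linarith
  let Δ := {k : Fin K // k ≠ i} × Fin S
  let f : (Fin N × Fin L) × Δ → Fin S × (Fin K × Fin K × Fin N × Fin L) :=
    fun e => (e.2.2, (e.2.1.1, i, e.1))
  have hf : Function.Injective f := by
    rintro ⟨p, ⟨k, hk⟩, r⟩ ⟨p', ⟨k', hk'⟩, r'⟩ h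
    simp only [f, Prod.mk.injEq, true_and] at h
    obtain ⟨rfl, rfl, rfl⟩ := h
    rfl
  have hΔ : Fintype.card Δ = (K - 1) * S := by
    simp [Δ, Fintype.card_subtype_compl]
  let B : Set ℂ := {z | ‖z‖ ^ 2 ≤ ρ}
  have hB : MeasurableSet B := measurableSet_le (by fun_prop) measurable_const
  let E : Fin N × Fin L → Set (Fin S × (Fin K × Fin K × Fin N × Fin L) → ℂ) :=
    fun p => {g | ∀ d, g (f (p, d)) ∈ B}
  have hE : ∀ p, MeasurableSet (E p) := fun p => by
    simp only [E, Set.ofPred_forall]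
    exact MeasurableSet.iInter fun d => measurable_pi_apply (f (p, d)) hB
  have hmeas := measure_biInter_forall_mem (complexGaussian v) hf hB
  have hEγ : ∀ p, γ (E p) = complexGaussian v B ^ Fintype.card Δ := fun p => by
    simpa using hmeas {p}
  have hind : iIndepSet E γ := by
    rw [iIndepSet_iff_meas_biInter hE]
    intro T
    simp_rw [hEγ]
    exact hmeas T
  have hq : ∀ p, (c * ρ) ^ ((K - 1) * S) ≤ γ.real (E p) := by
    intro p
    rw [measureReal_def, hEγ, ENNReal.toReal_pow, hΔ]
    refine pow_le_pow_left₀ (by positivity) ?_ _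
    exact (ENNReal.ofReal_le_iff_le_toReal (measure_ne_top _ _)).1 (hc ρ hρ0 hρ1)
  have hsub : ∀ g p, g ∈ E p → lif (trivialBases K S) (tableChannel g) i p.1 p.2 ≤ δ := by
    intro g p hg
    rw [lif_tableChannel]
    calc _ ≤ ∑ k ∈ Finset.univ.filter (fun k => k ≠ i), ∑ _r : Fin S, ρ :=
          Finset.sum_le_sum fun k hk => Finset.sum_le_sum fun r _ =>
            hg (⟨k, (Finset.mem_filter.1 hk).2⟩, r)
      _ ≤ ∑ _k : Fin K, ∑ _r : Fin S, ρ :=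
          Finset.sum_le_sum_of_subset_of_nonneg (Finset.subset_univ _)
            fun _ _ _ => Finset.sum_nonneg fun _ _ => hρ0
      _ = δ := by
          simp only [Finset.sum_const, Finset.card_univ, Fintype.card_fin, nsmul_eq_mul, hρ]
          field_simp
  have hmain := measureReal_card_le_le hE hind hq S
  rw [Fintype.card_prod, Fintype.card_fin, Fintype.card_fin, Nat.cast_mul] at hmain
  refine le_trans (measure_mono fun g hg => ?_) (ENNReal.le_ofReal_iff_toReal_le
    (measure_ne_top _ _) (by positivity) |>.2 hmain)
  rw [Set.mem_ofPred_eq] at hg ⊢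
  refine le_trans (Finset.card_le_card fun p hp => ?_) hg.le
  rw [Finset.mem_filter] at hp ⊢
  exact ⟨hp.1, hsub g p hp.2⟩

end Leakage

/-! ### Size of the zero-forcing equalizer. -/

section ZeroForcing

variable {S : ℕ}

/-- The columns of the zero-forcing equalizer of an effective channel matrix. -/
noncomputable def zfColumn (x : Fin S × Fin S → ℂ) (s : Fin S) : EuclideanSpace ℂ (Fin S) :=
  WithLp.toLp 2 fun r => ((Matrix.of fun r s => x (r, s))⁻¹)ᴴ r s

lemma zfVector_tableChannel {K N L : ℕ} (g : Fin S × (Fin K × Fin K × Fin N × Fin L) → ℂ)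
    (a : Fin K → Allocation N L S) (i : Fin K) (s : Fin S) :
    zfVector (trivialBases K S) (tableChannel g) a i s = zfColumn (ownEntries g i (a i)) s := by
  unfold zfVector zfEqualizer effectiveChannel zfColumn ownEntries
  simp_rw [projectedChannel_tableChannel]

/-- By Cramer's rule an entry of the inverse is an adjugate entry times the inverse determinant.
Scalar inversion is measurable also at `0`, so singular matrices need no separate case. -/
lemma measurable_norm_sq_zfColumn (s : Fin S) :
    Measurable fun x : Fin S × Fin S → ℂ => ‖zfColumn x s‖ ^ 2 := by
  simp_rw [EuclideanSpace.norm_sq_eq]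
  refine Finset.measurable_sum _ fun r _ => Measurable.pow_const (Measurable.norm ?_) 2
  have hA : Continuous fun x : Fin S × Fin S → ℂ =>
      (Matrix.of fun r s => x (r, s) : Matrix (Fin S) (Fin S) ℂ) :=
    continuous_matrix fun r s => continuous_apply (r, s)
  have hadj : Continuous fun x : Fin S × Fin S → ℂ =>
      (Matrix.of fun r s => x (r, s) : Matrix (Fin S) (Fin S) ℂ).adjugate s r :=
    hA.matrix_adjugate.matrix_elem s r
  simp only [zfColumn, Matrix.conjTranspose_apply, Matrix.inv_def, Ring.inverse_eq_inv',
    Matrix.smul_apply, smul_eq_mul, RCLike.star_def]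
  exact Complex.continuous_conj.measurable.comp
    (hA.matrix_det.measurable.inv.mul hadj.measurable)

/-- A zero column would be a zero row of the inverse, whose determinant is nonzero. -/
lemma norm_zfColumn_pos {x : Fin S × Fin S → ℂ} (hx : (Matrix.of fun r s => x (r, s)).det ≠ 0)
    (s : Fin S) : 0 < ‖zfColumn x s‖ := by
  rw [norm_pos_iff]
  intro h0
  have hdet : ((Matrix.of fun r s => x (r, s))⁻¹).det = 0 := by
    refine Matrix.det_eq_zero_of_row_eq_zero s fun r => ?_
    have := congrArg (fun y : EuclideanSpace ℂ (Fin S) => y r) h0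
    simpa [zfColumn] using this
  rw [Matrix.det_nonsing_inv, Ring.inverse_eq_inv'] at hdet
  exact hx (inv_eq_zero.1 hdet)

/-- The effective channel matrices with an equalizer whose columns are too long or too short. -/
def zfExceptional (S n : ℕ) : Set (Fin S × Fin S → ℂ) :=
  {x | ∀ s, 1 / ((n : ℝ) + 1) ≤ ‖zfColumn x s‖ ^ 2 ∧ ‖zfColumn x s‖ ^ 2 ≤ (n : ℝ) + 1}ᶜ

lemma measurableSet_zfExceptional (n : ℕ) : MeasurableSet (zfExceptional S n) := by
  refine MeasurableSet.compl ?_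
  simp only [Set.ofPred_forall]
  refine MeasurableSet.iInter fun s => ?_
  exact (measurableSet_le measurable_const (measurable_norm_sq_zfColumn s)).inter
    (measurableSet_le (measurable_norm_sq_zfColumn s) measurable_const)

/-- The exceptional sets decrease, and their intersection contains only singular matrices: finitely
many positive column lengths eventually fit between the bounds. -/
lemma tendsto_measure_zfExceptional (μ : Measure ℂ) [IsProbabilityMeasure μ]
    [NullSingletonClass μ] :
    Tendsto (fun n => (Measure.pi fun _ : Fin S × Fin S => μ) (zfExceptional S n)) atTop (𝓝 0) := by
  have hanti : Antitone (zfExceptional S) := by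
    intro m n hmn
    refine Set.compl_subset_compl.2 fun x hx s => ?_
    have h : (m : ℝ) ≤ n := by exact_mod_cast hmn
    refine ⟨le_trans ?_ (hx s).1, (hx s).2.trans (by linarith)⟩
    gcongr
  have h := tendsto_measure_iInter_atTop (μ := Measure.pi fun _ : Fin S × Fin S => μ)
    (fun n => (measurableSet_zfExceptional n).nullMeasurableSet) hanti ⟨0, measure_ne_top _ _⟩
  suffices h0 : (Measure.pi fun _ : Fin S × Fin S => μ) (⋂ n, zfExceptional S n) = 0 by
    rw [h0] at h
    exact h
  refine measure_mono_null (fun x hx => ?_) (pi_det_eq_zero (S := S) μ)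
  by_contra hdet
  have hpos := norm_zfColumn_pos hdet
  have hev : ∀ᶠ n : ℕ in atTop,
      ∀ s, 1 / ((n : ℝ) + 1) ≤ ‖zfColumn x s‖ ^ 2 ∧ ‖zfColumn x s‖ ^ 2 ≤ (n : ℝ) + 1 := by
    rw [eventually_all]
    intro s
    have h1 : ∀ᶠ n : ℕ in atTop, 1 / ((n : ℝ) + 1) < ‖zfColumn x s‖ ^ 2 :=
      tendsto_one_div_add_atTop_nhds_zero_nat.eventually_lt_const (pow_pos (hpos s) 2)
    have h2 : ∀ᶠ n : ℕ in atTop, ‖zfColumn x s‖ ^ 2 ≤ (n : ℝ) :=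
      tendsto_natCast_atTop_atTop.eventually_ge_atTop _
    filter_upwards [h1, h2] with n h1 h2
    exact ⟨h1.le, by linarith⟩
  obtain ⟨n, hn⟩ := hev.exists
  exact Set.mem_iInter.1 hx n hn

end ZeroForcing

/-! ### The scaling condition and the limit in probability. -/

/-- The quantity is `b ^ d` times the reciprocal of the ratio that tends to `0`. Positivity of the
ratio sends the reciprocal to `+∞`. -/
lemma tendsto_mul_pow_atTop_of_isLittleO {N L : ℝ → ℕ} {d : ℕ} (hNL : ∀ snr, 0 < N snr * L snr)
    (hscale : (fun snr : ℝ => (L snr : ℝ)⁻¹ * snr ^ d) =o[atTop] (fun snr => (N snr : ℝ)))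
    {b : ℝ} (hb : 0 < b) :
    Tendsto (fun snr : ℝ => (N snr : ℝ) * L snr * (b * (1 / snr)) ^ d) atTop atTop := by
  have hN : ∀ snr, (0 : ℝ) < N snr := fun snr => by
    exact_mod_cast Nat.pos_of_mul_pos_right (hNL snr)
  have hL : ∀ snr, (0 : ℝ) < L snr := fun snr => by
    exact_mod_cast Nat.pos_of_mul_pos_left (hNL snr)
  have h0 := hscale.tendsto_div_nhds_zero
  have h1 : Tendsto (fun snr : ℝ => (L snr : ℝ)⁻¹ * snr ^ d / N snr) atTop (𝓝[>] 0) := by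
    refine tendsto_nhdsWithin_iff.2 ⟨h0, ?_⟩
    filter_upwards [eventually_gt_atTop 0] with snr hsnr
    have := hN snr
    have := hL snr
    exact Set.mem_Ioi.2 (by positivity)
  refine (h1.inv_tendsto_nhdsGT_zero.atTop_mul_const (pow_pos hb d)).congr' ?_
  filter_upwards [eventually_gt_atTop 0] with snr hsnr
  have := hN snr
  have := hL snr
  simp only [Pi.inv_apply]
  rw [mul_pow, div_pow, one_pow]
  field_simp

/-- The sum-rate is close to `K * S * log snr` if in every cell the equalizer is well-behaved and
many antennas have a small LIF metric. -/
lemma abs_sumRate_tableChannel_sub_log_le {K N L S : ℕ} (hS : 1 ≤ S)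
    (g : Fin S × (Fin K × Fin K × Fin N × Fin L) → ℂ)
    {sel : Fin K → (Fin N → Fin L → ℝ) → Allocation N L S}
    (hsel : ∀ i, IsGeneralSelectionRule (sel i)) {snr : ℝ} (hsnr : 1 ≤ snr) (n : ℕ)
    (hzf : ∀ i, ownEntries g i (sel i (lif (trivialBases K S) (tableChannel g) i)) ∉
      zfExceptional S n)
    (hlif : ∀ i, S ≤ (Finset.univ.filter fun p : Fin N × Fin L =>
      lif (trivialBases K S) (tableChannel g) i p.1 p.2 ≤ 1 / snr).card) :
    |sumRate snr (trivialBases K S) (tableChannel g)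
        (fun i => sel i (lif (trivialBases K S) (tableChannel g) i)) - K * S * Real.log snr| ≤
      K * S * (Real.log (1 + 1 / (1 / ((n : ℝ) + 1))) +
        Real.log (((n : ℝ) + 1) * (1 + K * S * S))) := by
  refine abs_sumRate_sub_log_le hsnr (by positivity) (by simp) (fun i s => ?_) fun k m => ?_
  · rw [zfVector_tableChannel]
    have := hzf i
    rw [zfExceptional, Set.notMem_compl_iff] at this
    exact this s
  · have hopt := (hsel k).optimal (lif (trivialBases K S) (tableChannel g) k)
    have h0 : ∀ j l, 0 ≤ lif (trivialBases K S) (tableChannel g) k j l :=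
      fun j l => lif_nonneg k j l
    exact hopt.stream_le h0 hS (hlif k) m

/-- The sum-rate deviates from `K * S * log snr` with small probability. -/
lemma measure_abs_sumRate_sub_log_gt_le {Ω : Type*} [MeasurableSpace Ω] {P : Measure Ω}
    [IsProbabilityMeasure P] {K N M L S : ℕ} (hS : 1 ≤ S)
    {U : Ω → Fin K → Matrix (Fin M) (Fin S) ℂ}
    (hUo : ∀ ω k, (U ω k)ᴴ * U ω k = 1) (hU : ∀ k m s, Measurable (fun ω => U ω k m s))
    {v : ℝ≥0} {H : Ω → Channel K N M L} (hH : IsGaussianChannel P v H)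
    (hUH : IndepFun (fun ω k m s => U ω k m s) (fun ω k i j m l => H ω k i j m l) P)
    {sel : Fin K → (Fin N → Fin L → ℝ) → Allocation N L S}
    (hsel : ∀ i, IsGeneralSelectionRule (sel i)) {c : ℝ} (hc0 : 0 < c)
    (hc : ∀ r : ℝ, 0 ≤ r → r ≤ 1 → ENNReal.ofReal (c * r) ≤ complexGaussian v {z | ‖z‖ ^ 2 ≤ r})
    {snr : ℝ} (hsnr : 1 ≤ snr) (n : ℕ) :
    P {ω | K * S * (Real.log (1 + 1 / (1 / ((n : ℝ) + 1))) +
        Real.log (((n : ℝ) + 1) * (1 + K * S * S))) <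
      |sumRate snr (U ω) (H ω) (fun i => sel i (lif (U ω) (H ω) i)) - K * S * Real.log snr|} ≤
      K * (Measure.pi fun _ => complexGaussian v) (zfExceptional S n) +
      K * ENNReal.ofReal (Real.exp S * Real.exp (-(N * L *
        (c * (1 / snr / (K * S))) ^ ((K - 1) * S) * (1 - Real.exp (-1))))) := by
  have hlaw := hasLaw_projectedTable hUo hU hH hUH
  let C₁ : Fin K → Set (Fin S × (Fin K × Fin K × Fin N × Fin L) → ℂ) := fun i =>
    {g | ownEntries g i (sel i (lif (trivialBases K S) (tableChannel g) i)) ∈ zfExceptional S n}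
  let C₂ : Fin K → Set (Fin S × (Fin K × Fin K × Fin N × Fin L) → ℂ) := fun i =>
    {g | (Finset.univ.filter fun p : Fin N × Fin L =>
      lif (trivialBases K S) (tableChannel g) i p.1 p.2 ≤ 1 / snr).card < S}
  have hsub : {ω | K * S * (Real.log (1 + 1 / (1 / ((n : ℝ) + 1))) +
        Real.log (((n : ℝ) + 1) * (1 + K * S * S))) <
      |sumRate snr (U ω) (H ω) (fun i => sel i (lif (U ω) (H ω) i)) - K * S * Real.log snr|} ⊆
      (fun ω => projectedTable (U ω) (H ω)) ⁻¹' ((⋃ i, C₁ i) ∪ ⋃ i, C₂ i) := by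
    intro ω hω
    by_contra hcon
    simp only [Set.mem_preimage, Set.mem_union, Set.mem_iUnion, not_or, not_exists] at hcon
    have h := abs_sumRate_tableChannel_sub_log_le hS (projectedTable (U ω) (H ω)) hsel hsnr n
      hcon.1 fun i => not_lt.1 (hcon.2 i)
    rw [sumRate_projectedTable] at h
    simp_rw [lif_projectedTable] at h
    exact absurd hω (not_lt.2 h)
  -- The inequality holds for arbitrary sets, so the bad events need not be shown measurable.
  have hγ : ∀ A, P ((fun ω => projectedTable (U ω) (H ω)) ⁻¹' A) ≤
      (Measure.pi fun _ => complexGaussian v) A := fun A => by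
    rw [← hlaw.map_eq]
    exact Measure.le_map_apply hlaw.aemeasurable A
  refine (measure_mono hsub).trans ((hγ _).trans ((measure_union_le _ _).trans (add_le_add ?_ ?_)))
  · refine (measure_iUnion_fintype_le _ _).trans ?_
    refine (Finset.sum_le_sum fun i _ => measure_ownEntries_le (complexGaussian v) i (hsel i)
      (measurableSet_zfExceptional n)).trans ?_
    simp
  · refine (measure_iUnion_fintype_le _ _).trans ?_
    refine (Finset.sum_le_sum fun i _ => measure_card_lif_le_lt_le hc0 hc i hS
      (by positivity) ((div_le_one (by linarith)).2 hsnr)).trans ?_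
    simp

theorem corollary1 {Ω : Type*} [MeasurableSpace Ω] (P : Measure Ω) [IsProbabilityMeasure P]
    (K M S : ℕ) (hK : 1 ≤ K) (hS : 1 ≤ S) (hSM : S ≤ M)
    -- numbers of users per cell and of antennas per user, as functions of the SNR
    (N L : ℝ → ℕ) (hNL : ∀ snr, S ≤ N snr * L snr)
    -- the reference bases
    (Q : Ω → Fin K → Matrix (Fin M) (Fin (M - S)) ℂ) (U : Ω → Fin K → Matrix (Fin M) (Fin S) ℂ)
    (hQU : ∀ ω k, IsReferenceBasis (Q ω k) (U ω k))
    (hU : ∀ k m s, Measurable (fun ω => U ω k m s))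
    -- the channels
    (v : ℝ≥0) (hv : 0 < v)
    (H : (snr : ℝ) → Ω → Channel K (N snr) M (L snr))
    (hH : ∀ snr, IsGaussianChannel P v (H snr))
    (hUH : ∀ snr, IndepFun (fun ω k m s => U ω k m s) (fun ω k i j m l => H snr ω k i j m l) P)
    -- the selection rule of each cell
    (sel : (snr : ℝ) → Fin K → (Fin (N snr) → Fin (L snr) → ℝ) → Allocation (N snr) (L snr) S)
    (hsel : ∀ snr i, IsGeneralSelectionRule (sel snr i))
    -- the user scaling condition
    (hscale : (fun snr : ℝ => (L snr : ℝ)⁻¹ * snr ^ ((K - 1) * S))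
      =o[atTop] (fun snr => (N snr : ℝ))) :
    AchievesDoFWithHighProbability P
      (fun snr ω => sumRate snr (U ω) (H snr ω)
        (fun i => sel snr i (lif (U ω) (H snr ω) i)))
      ((K : ℝ) * S) := by
  have hnull := nullSingletonClass_complexGaussian hv
  obtain ⟨c, hc0, hc⟩ := exists_complexGaussian_ball_ge hv
  have hKS : (0 : ℝ) < K * S := by exact_mod_cast Nat.mul_pos hK hS
  have hA := tendsto_mul_pow_atTop_of_isLittleO (fun snr => lt_of_lt_of_le hS (hNL snr)) hscale
    (div_pos hc0 hKS)
  have he : 0 < 1 - Real.exp (-1) := by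
    have := Real.exp_lt_one_iff.2 (show (-1 : ℝ) < 0 by norm_num)
    linarith
  have hleak : Tendsto (fun snr : ℝ => (K : ENNReal) * ENNReal.ofReal (Real.exp S *
      Real.exp (-(N snr * L snr * (c * (1 / snr / (K * S))) ^ ((K - 1) * S) *
        (1 - Real.exp (-1)))))) atTop (𝓝 0) := by
    have h1 := (Real.tendsto_exp_neg_atTop_nhds_zero.comp (hA.atTop_mul_const he)).const_mul
      (Real.exp S)
    rw [mul_zero] at h1
    have h2 := ENNReal.Tendsto.const_mul (a := (K : ENNReal)) (ENNReal.tendsto_ofReal h1)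
      (Or.inr (ENNReal.natCast_ne_top K))
    rw [ENNReal.ofReal_zero, mul_zero] at h2
    refine h2.congr fun snr => ?_
    simp only [Function.comp_apply]
    congr 8
    ring
  have hzf : Tendsto (fun n => (K : ENNReal) *
      (Measure.pi fun _ => complexGaussian v) (zfExceptional S n)) atTop (𝓝 0) := by
    simpa using ENNReal.Tendsto.const_mul (a := (K : ENNReal))
      (tendsto_measure_zfExceptional (S := S) (complexGaussian v))
      (Or.inr (ENNReal.natCast_ne_top K))
  rw [AchievesDoFWithHighProbability, tendstoInMeasure_iff_dist]
  intro ε hε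
  rw [ENNReal.tendsto_nhds_zero]
  intro η hη
  have hη2 : 0 < η / 2 := ENNReal.half_pos hη.ne'
  -- `n` is fixed before the SNR grows, since the equalizer estimate is uniform in it. Hence `D` is
  -- a constant, eventually below `ε * log snr`.
  obtain ⟨n, hn⟩ := ((ENNReal.tendsto_nhds_zero.1 hzf) (η / 2) hη2).exists
  set D := K * S * (Real.log (1 + 1 / (1 / ((n : ℝ) + 1))) +
    Real.log (((n : ℝ) + 1) * (1 + K * S * S))) with hD
  filter_upwards [(ENNReal.tendsto_nhds_zero.1 hleak) (η / 2) hη2, eventually_gt_atTop 1,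
    (Real.tendsto_log_atTop.const_mul_atTop hε).eventually_gt_atTop D] with snr h1 h2 h3
  have hlog : 0 < Real.log snr := Real.log_pos h2
  refine le_trans (measure_mono fun ω hω => ?_) ((measure_abs_sumRate_sub_log_gt_le hS
    (fun ω k => (hQU ω k).orthonormal) hU (hH snr) (hUH snr) (hsel snr) hc0 hc h2.le n).trans
      ((add_le_add hn h1).trans (ENNReal.add_halves η).le))
  rw [Set.mem_ofPred_eq, Real.dist_eq] at hω
  rw [Set.mem_ofPred_eq]
  refine lt_of_lt_of_le h3 ?_
  rw [div_sub' hlog.ne', abs_div, abs_of_pos hlog, le_div_iff₀ hlog] at hω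
  rwa [mul_comm (Real.log snr)] at hω
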